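/- Let $G=(V,w,m)$ be a finite measured and weighted graph, i.e. $V$ is a finite set, $w\colon V\times V\to[0,\infty)$ is symmetric and zero on the diagonal, and $m\colon V\to(0,\infty)$. Vertices $x,y$ are adjacent iff $w(x,y)>0$; assume that $G$ is connected. For $f,g\colon V\to\mathbb R$ let $\Delta f(x)=\sum_{y}\frac{w(x,y)}{m(x)}(f(y)-f(x))$, $\Gamma(f,g)=\frac12(\Delta(fg)-f\Delta g-g\Delta f)$ and $\Gamma_2(f,g)=\frac12(\Delta\Gamma(f,g)-\Gamma(f,\Delta g)-\Gamma(g,\Delta f))$. Suppose that $G$ has non-negative Bakry–Émery curvature everywhere and positive curvature at some vertex, i.e. there is a function $\rho\colon V\to[0,\infty)$ with $\rho(x_0)>0$ for some $x_0\in V$ such that $G$ satisfies $CD(\rho,\infty)$: $\Gamma_2(f,f)(x)\ge\rho(x)\,\Gamma(f,f)(x)$ for all $f\colon V\to\mathbb R$ and $x\in V$. Then the fundamental group (at any base point) of the 2-dimensional CW complex obtained from the graph as $1$-skeleton by filling every cycle of length $3$ or $4$ with a disk is finite. -/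

import Mathlib

open scoped ENNReal

noncomputable section

/-- A measured and weighted graph on the vertex set `V`: a symmetric weight
`w : V × V → [0,∞)` vanishing on the diagonal and a measure `m : V → (0,∞)`. -/
structure MeasuredWeightedGraph (V : Type*) where
  w : V → V → ℝ
  m : V → ℝ
  w_nonneg : ∀ x y, 0 ≤ w x y
  w_symm : ∀ x y, w x y = w y x
  w_self : ∀ x, w x x = 0
  m_pos : ∀ x, 0 < m x

namespace MeasuredWeightedGraph

variable {V : Type*}

/-- The underlying combinatorial graph: `x ∼ y` iff `w x y > 0`. -/
def toSimpleGraph (G : MeasuredWeightedGraph V) : SimpleGraph V where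
  Adj x y := 0 < G.w x y
  symm := ⟨fun x y h => by rw [G.w_symm y x]; exact h⟩
  loopless := ⟨fun x h => by rw [G.w_self x] at h; exact lt_irrefl 0 h⟩

variable [Fintype V]

/-- The Laplacian `Δf(x) = ∑_y (w(x,y)/m(x)) (f(y) - f(x))`. -/
def laplacian (G : MeasuredWeightedGraph V) (f : V → ℝ) : V → ℝ :=
  fun x => ∑ y, G.w x y / G.m x * (f y - f x)

/-- The carré du champ operator `Γ(f,g) = ½(Δ(fg) - f Δg - g Δf)`. -/
def gamma (G : MeasuredWeightedGraph V) (f g : V → ℝ) : V → ℝ :=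
  fun x => (1 / 2 : ℝ) *
    (G.laplacian (fun y => f y * g y) x - f x * G.laplacian g x - g x * G.laplacian f x)

/-- The iterated operator `Γ₂(f,g) = ½(ΔΓ(f,g) - Γ(f,Δg) - Γ(g,Δf))`. -/
def gamma₂ (G : MeasuredWeightedGraph V) (f g : V → ℝ) : V → ℝ :=
  fun x => (1 / 2 : ℝ) *
    (G.laplacian (G.gamma f g) x - G.gamma f (G.laplacian g) x - G.gamma g (G.laplacian f) x)

/-- The variable Bakry–Émery curvature dimension condition `CD(ρ,n)`, for `0 < n ≤ ∞`
(with `1/∞ = 0`): `Γ₂(f)(x) ≥ ρ(x) Γ(f)(x) + (1/n) (Δf(x))²` for all `f` and `x`. -/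
def CD (G : MeasuredWeightedGraph V) (ρ : V → ℝ) (n : ℝ≥0∞) : Prop :=
  ∀ (f : V → ℝ) (x : V),
    ρ x * G.gamma f f x + (n⁻¹).toReal * (G.laplacian f x) ^ 2 ≤ G.gamma₂ f f x

end MeasuredWeightedGraph

namespace SimpleGraph

variable {V : Type*}

/-- `c` is the edge set of a cycle of length 3 or 4 of `G` (a closed walk without repeated
vertices). A cycle as a subgraph is determined by its edge set. -/
def IsShortCycle (G : SimpleGraph V) (c : Set (Sym2 V)) : Prop :=
  ∃ (v : V) (p : G.Walk v v),
    p.IsCycle ∧ (p.length = 3 ∨ p.length = 4) ∧ c = p.edgeSet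

open Classical in
/-- The standard basis vector of the ambient real vector space, which has one coordinate for
each vertex of the graph and one for each set of edges; only the coordinates belonging to
3- and 4-cycles are used, namely for the centres of the disks. -/
def basisPoint (i : V ⊕ Set (Sym2 V)) : V ⊕ Set (Sym2 V) → ℝ :=
  Pi.single i 1

/-- The 2-dimensional complex of a finite graph `G`: its 1-skeleton is the geometric realization
of `G` (a point for every vertex, a segment for every edge), and every cycle `c` of length 3
or 4 is filled with a disk. The disk filling `c` is realized as the cone over the polygon `c`
with an apex of its own, that is, as the union of the triangles spanned by that apex and the
edges of `c`; so different disks meet only in the 1-skeleton. The ambient space is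
finite-dimensional, and the complex carries the subspace topology. -/
def filledComplex [Finite V] (G : SimpleGraph V) : Set (V ⊕ Set (Sym2 V) → ℝ) :=
  {p | ∃ v : V, p = basisPoint (Sum.inl v)} ∪
  {p | ∃ a b : V, G.Adj a b ∧
    p ∈ segment ℝ (basisPoint (Sum.inl a)) (basisPoint (Sum.inl b))} ∪
  {p | ∃ (c : Set (Sym2 V)) (a b : V), G.IsShortCycle c ∧ s(a, b) ∈ c ∧
    p ∈ convexHull ℝ {basisPoint (Sum.inl a), basisPoint (Sum.inl b), basisPoint (Sum.inr c)}}

end SimpleGraph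

end

/-! The vertices of the universal cover are the homotopy classes of paths from `p` to vertices of
the graph. The fundamental group injects into one fibre, so it suffices that this cover is finite.

Geometry: `Γ₂` at a vertex sees only its ball of radius two. As triangles and squares lift to closed
walks, functions on the cover descend on such balls, and the curvature condition lifts (`CD.cover`).

Analysis: by the maximum principle, `(2ρ - Δ)φ = 1` has a positive solution on the finite graph
(`exists_pos_solution`). For bounded `u` with `(l - Δ)u = g`, a maximum principle for `Γ(u)/φ`
bounds `Γ(u)` by a multiple of `sup Γ(g)`, uniformly in `l` (`coverGamma_resolvent_le`). Take for
`g` the truncated distance to a base point. Then `Δu = l u - g` is bounded independently of the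
truncation, while `l u` is almost constant between the two points compared once `l` is small. So the
distance is bounded, and `finite_cover` follows from finite degree.

Topology: the cover is connected because every path between vertices is homotopic to an edge path
(`isEdgePath`). This is proved by subdividing a path into pieces inside open stars, whose closed
stars are star convex. -/

namespace SimpleGraph

/-! ### Covers in which short cycles lift -/

/-- A graph over `G`, given by a projection to `V` and by lifting of edges, in which
all triangles and all squares of `G` lift to closed walks. -/
structure ShortCycleCover {V : Type*} (G : SimpleGraph V) (X : Type*) where
  proj : X → V
  step : X → V → X
  proj_step : ∀ x y, G.Adj (proj x) y → proj (step x y) = y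
  step_back : ∀ x y, G.Adj (proj x) y → step (step x y) (proj x) = x
  step_triangle : ∀ x y z, G.Adj (proj x) y → G.Adj y z → G.Adj (proj x) z →
    step (step x y) z = step x z
  step_square : ∀ x y y' z, G.Adj (proj x) y → G.Adj (proj x) y' → G.Adj y z → G.Adj y' z →
    y ≠ y' → proj x ≠ z → step (step x y) z = step (step x y') z

end SimpleGraph

/-! ### A positive potential, and lifting the curvature condition -/

namespace MeasuredWeightedGraph

variable {V : Type*} (G : MeasuredWeightedGraph V)

/-- The transition rate from `x` to `y`. -/
noncomputable def rate (x y : V) : ℝ := G.w x y / G.m x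

lemma rate_nonneg (x y : V) : 0 ≤ G.rate x y := div_nonneg (G.w_nonneg x y) (G.m_pos x).le

lemma rate_pos {x y : V} (h : G.toSimpleGraph.Adj x y) : 0 < G.rate x y :=
  div_pos h (G.m_pos x)

lemma rate_eq_zero {x y : V} (h : ¬ G.toSimpleGraph.Adj x y) : G.rate x y = 0 := by
  have : G.w x y = 0 := le_antisymm (not_lt.1 h) (G.w_nonneg x y)
  simp [rate, this]

variable [Fintype V]

lemma laplacian_apply (f : V → ℝ) (x : V) :
    G.laplacian f x = ∑ y, G.rate x y * (f y - f x) := rfl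

lemma gamma_apply (f g : V → ℝ) (x : V) :
    G.gamma f g x = (1 / 2 : ℝ) * ∑ y, G.rate x y * ((f y - f x) * (g y - g x)) := by
  simp only [gamma, laplacian_apply, Finset.mul_sum, ← Finset.sum_sub_distrib]
  exact Finset.sum_congr rfl fun y _ => by ring

/-- The sum over the neighbours of `x` only depends on the values at the neighbours. -/
lemma sum_rate_congr (x : V) {a b : V → ℝ}
    (h : ∀ y, G.toSimpleGraph.Adj x y → a y = b y) :
    ∑ y, G.rate x y * a y = ∑ y, G.rate x y * b y := by
  refine Finset.sum_congr rfl fun y _ => ?_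
  by_cases hy : G.toSimpleGraph.Adj x y
  · rw [h y hy]
  · simp [G.rate_eq_zero hy]

/-- On a connected graph with a nonnegative potential that does not vanish identically, there is
a positive function `φ` with `(2ρ - Δ) φ = 1`. -/
theorem exists_pos_solution (hconn : G.toSimpleGraph.Connected) {ρ : V → ℝ}
    (hnonneg : ∀ x, 0 ≤ ρ x) (hpos : ∃ x, 0 < ρ x) :
    ∃ φ : V → ℝ, (∀ x, 0 < φ x) ∧ ∀ x, 2 * ρ x * φ x - G.laplacian φ x = 1 := by
  have := hconn.nonempty
  obtain ⟨x₀, hx₀⟩ := hpos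
  let T : (V → ℝ) →ₗ[ℝ] (V → ℝ) :=
    { toFun := fun f x => 2 * ρ x * f x - G.laplacian f x
      map_add' := fun f g => by
        funext x
        simp only [laplacian_apply, Pi.add_apply]
        rw [sub_add_sub_comm, ← Finset.sum_add_distrib]
        congr 1
        · ring
        · exact Finset.sum_congr rfl fun y _ => by ring
      map_smul' := fun c f => by
        funext x
        simp only [laplacian_apply, Pi.smul_apply, smul_eq_mul, RingHom.id_apply, mul_sub,
          Finset.mul_sum]
        congr 1
        · ring
        · exact Finset.sum_congr rfl fun y _ => by ring }
  -- Maximum principle: at a positive maximum both terms of the equation must vanish, so `ρ` is zero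
  -- there and all neighbours are maxima too. Connectedness carries this to `x₀`, where `ρ` is
  -- positive.
  have key : ∀ f : V → ℝ, T f = 0 → ∀ x, f x ≤ 0 := by
    intro f hf
    obtain ⟨z, hz⟩ := Finite.exists_max f
    by_contra! hcon
    obtain ⟨x₁, hx₁⟩ := hcon
    have hM : 0 < f z := hx₁.trans_le (hz x₁)
    have hmax : ∀ x, f x = f z → (ρ x = 0 ∧ ∀ y, G.toSimpleGraph.Adj x y → f y = f z) := by
      intro x hx
      have h0 : 2 * ρ x * f x - G.laplacian f x = 0 := congrFun hf x
      have hterm : ∀ y ∈ Finset.univ, G.rate x y * (f y - f x) ≤ 0 := fun y _ =>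
        mul_nonpos_of_nonneg_of_nonpos (G.rate_nonneg x y) (by rw [hx]; linarith [hz y])
      have hlap : G.laplacian f x ≤ 0 := Finset.sum_nonpos hterm
      have hρ : 0 ≤ 2 * ρ x * f x := by rw [hx]; have := hnonneg x; positivity
      have h1 : G.laplacian f x = 0 := by linarith
      refine ⟨?_, fun y hy => ?_⟩
      · have : 2 * ρ x * f z = 0 := by rw [← hx]; linarith
        simpa [hM.ne'] using this
      · have := (Finset.sum_eq_zero_iff_of_nonpos hterm).1 h1 y (Finset.mem_univ y)
        rcases mul_eq_zero.1 this with h | h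
        · exact absurd h (G.rate_pos hy).ne'
        · linarith
    have hall : ∀ x, f x = f z := by
      intro x
      obtain ⟨p⟩ := hconn.preconnected z x
      have : ∀ {a b : V}, G.toSimpleGraph.Walk a b → f a = f z → f b = f z := by
        intro a b p
        induction p with
        | nil => exact id
        | cons h _ ih => exact fun ha => ih ((hmax _ ha).2 _ h)
      exact this p rfl
    exact hx₀.ne' (hmax x₀ (hall x₀)).1
  have hinj : Function.Injective T := by
    rw [← LinearMap.ker_eq_bot, LinearMap.ker_eq_bot']
    intro f hf
    funext x
    refine le_antisymm (key f hf x) ?_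
    have := key (-f) (by rw [map_neg, hf, neg_zero]) x
    simpa using this
  obtain ⟨φ, hφ⟩ := LinearMap.surjective_of_injective hinj (fun _ => 1)
  have hφ' : ∀ x, 2 * ρ x * φ x - G.laplacian φ x = 1 := fun x => congrFun hφ x
  refine ⟨φ, fun x => ?_, hφ'⟩
  obtain ⟨z, hz⟩ := Finite.exists_min φ
  refine lt_of_lt_of_le ?_ (hz x)
  by_contra! hcon
  have h1 : 0 ≤ G.laplacian φ z := Finset.sum_nonneg fun y _ =>
    mul_nonneg (G.rate_nonneg z y) (by linarith [hz y])
  have h2 : 2 * ρ z * φ z ≤ 0 :=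
    mul_nonpos_of_nonneg_of_nonpos (by have := hnonneg z; positivity) hcon
  linarith [hφ' z]

variable {G} {X : Type*} (C : G.toSimpleGraph.ShortCycleCover X)

/-- The Laplacian of the lifted weighted graph. -/
noncomputable def coverLaplacian (f : X → ℝ) (x : X) : ℝ :=
  ∑ y, G.rate (C.proj x) y * (f (C.step x y) - f x)

/-- The carré du champ operator of the lifted weighted graph. -/
noncomputable def coverGamma (f g : X → ℝ) (x : X) : ℝ :=
  (1 / 2 : ℝ) * ∑ y, G.rate (C.proj x) y * ((f (C.step x y) - f x) * (g (C.step x y) - g x))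

/-- A function near `x` descends to the ball of radius two around the projection of `x`. -/
lemma exists_descent (f : X → ℝ) (x : X) : ∃ f' : V → ℝ, f' (C.proj x) = f x ∧
    (∀ y, G.toSimpleGraph.Adj (C.proj x) y → f' y = f (C.step x y)) ∧
    ∀ y z, G.toSimpleGraph.Adj (C.proj x) y → G.toSimpleGraph.Adj y z →
      f' z = f (C.step (C.step x y) z) := by
  classical
  let Q : V → V → Prop := fun z y => G.toSimpleGraph.Adj (C.proj x) y ∧ G.toSimpleGraph.Adj y z
  -- At distance two the value uses a chosen midpoint; `step_square` makes the choice irrelevant.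
  -- The value `0` farther away is never seen.
  refine ⟨fun z => if z = C.proj x then f x else
    if G.toSimpleGraph.Adj (C.proj x) z then f (C.step x z) else
    if h : ∃ y, Q z y then f (C.step (C.step x h.choose) z) else 0, by simp, ?_, ?_⟩
  · intro y hy
    have hne : y ≠ C.proj x := hy.ne'
    simp [hne, hy]
  · intro y z hy hz
    by_cases hne : z = C.proj x
    · subst hne; simp [C.step_back x y hy]
    by_cases hadj : G.toSimpleGraph.Adj (C.proj x) z
    · simp [hne, hadj, C.step_triangle x y z hy hz hadj]
    · have h : ∃ y, Q z y := ⟨y, hy, hz⟩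
      simp only [hne, hadj, if_false, dif_pos h]
      by_cases hyy : h.choose = y
      · rw [hyy]
      · rw [C.step_square x h.choose y z h.choose_spec.1 hy h.choose_spec.2 hz hyy (Ne.symm hne)]

/-- The curvature condition lifts to the cover. -/
theorem CD.cover {ρ : V → ℝ} (hCD : G.CD ρ ⊤) (f : X → ℝ) (x : X) :
    2 * ρ (C.proj x) * coverGamma C f f x ≤
      coverLaplacian C (coverGamma C f f) x - 2 * coverGamma C f (coverLaplacian C f) x := by
  obtain ⟨f', h0, h1, h2⟩ := exists_descent C f x
  have lap0 : G.laplacian f' (C.proj x) = coverLaplacian C f x := by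
    rw [laplacian_apply]
    exact G.sum_rate_congr _ fun y hy => by rw [h0, h1 y hy]
  have gam0 : G.gamma f' f' (C.proj x) = coverGamma C f f x := by
    rw [gamma_apply]
    exact congrArg _ (G.sum_rate_congr _ fun y hy => by rw [h0, h1 y hy])
  have lap1 : ∀ y, G.toSimpleGraph.Adj (C.proj x) y →
      G.laplacian f' y = coverLaplacian C f (C.step x y) := by
    intro y hy
    rw [laplacian_apply, coverLaplacian, C.proj_step x y hy]
    exact G.sum_rate_congr _ fun z hz => by rw [h1 y hy, h2 y z hy hz]
  have gam1 : ∀ y, G.toSimpleGraph.Adj (C.proj x) y →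
      G.gamma f' f' y = coverGamma C f f (C.step x y) := by
    intro y hy
    rw [gamma_apply, coverGamma, C.proj_step x y hy]
    exact congrArg _ (G.sum_rate_congr _ fun z hz => by rw [h1 y hy, h2 y z hy hz])
  have lg : G.laplacian (G.gamma f' f') (C.proj x) = coverLaplacian C (coverGamma C f f) x := by
    rw [laplacian_apply, coverLaplacian]
    exact G.sum_rate_congr _ fun y hy => by rw [gam0, gam1 y hy]
  have gl : G.gamma f' (G.laplacian f') (C.proj x) = coverGamma C f (coverLaplacian C f) x := by
    rw [gamma_apply, coverGamma]
    exact congrArg _ (G.sum_rate_congr _ fun y hy => by rw [h0, h1 y hy, lap0, lap1 y hy])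
  have := hCD f' (C.proj x)
  rw [gamma₂, gam0, lg, gl] at this
  simp only [ENNReal.inv_top, ENNReal.toReal_zero, zero_mul, add_zero] at this
  linarith

end MeasuredWeightedGraph

/-! ### Lifted walks -/

namespace SimpleGraph.ShortCycleCover

variable {V : Type*} {G : SimpleGraph V} {X : Type*} (C : G.ShortCycleCover X)

/-- `C.Reaches x₀ n x` says that `x` is reached from `x₀` by lifting a walk of length `n`. -/
inductive Reaches (x₀ : X) : ℕ → X → Prop
  | zero : Reaches x₀ 0 x₀
  | succ {n : ℕ} {x : X} {y : V} : Reaches x₀ n x → G.Adj (C.proj x) y →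
      Reaches x₀ (n + 1) (C.step x y)

lemma finite_setOf_reaches [Finite V] (x₀ : X) (n : ℕ) : {x | C.Reaches x₀ n x}.Finite := by
  induction n with
  | zero =>
    refine (Set.finite_singleton x₀).subset ?_
    rintro x ⟨⟩
    rfl
  | succ n ih =>
    refine (Set.Finite.image2 C.step ih (Set.finite_univ (α := V))).subset ?_
    rintro _ (_ | ⟨hx, _⟩)
    exact ⟨_, hx, _, Set.mem_univ _, rfl⟩

lemma Reaches.abs_sub_le {x₀ : X} {u : X → ℝ} {K : ℝ}
    (hu : ∀ x y, G.Adj (C.proj x) y → |u (C.step x y) - u x| ≤ K) {n : ℕ} {x : X}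
    (h : C.Reaches x₀ n x) : |u x - u x₀| ≤ n * K := by
  induction h with
  | zero => simp
  | succ _ hadj ih =>
    refine (_root_.abs_sub_le _ _ _).trans ((add_le_add (hu _ _ hadj) ih).trans ?_)
    push_cast
    linarith

end SimpleGraph.ShortCycleCover

/-! ### Gradient estimate for the resolvent and diameter bound -/

namespace MeasuredWeightedGraph

variable {V : Type*} [Fintype V] {G : MeasuredWeightedGraph V} {X : Type*}
  (C : G.toSimpleGraph.ShortCycleCover X)

lemma coverGamma_self_nonneg (f : X → ℝ) (x : X) : 0 ≤ coverGamma C f f x :=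
  mul_nonneg (by norm_num) (Finset.sum_nonneg fun y _ =>
    mul_nonneg (G.rate_nonneg _ y) (mul_self_nonneg _))

/-- Cauchy–Schwarz with the rates as weights. -/
lemma coverLaplacian_sq_le {D : ℝ} (hD : ∀ v, ∑ y, G.rate v y ≤ D) (f : X → ℝ) (x : X) :
    coverLaplacian C f x ^ 2 ≤ 2 * D * coverGamma C f f x := by
  have h := Finset.sum_sq_le_sum_mul_sum_of_sq_le_mul Finset.univ
    (r := fun y => G.rate (C.proj x) y * (f (C.step x y) - f x))
    (f := fun y => G.rate (C.proj x) y)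
    (g := fun y => G.rate (C.proj x) y * ((f (C.step x y) - f x) * (f (C.step x y) - f x)))
    (fun y _ => G.rate_nonneg _ y)
    (fun y _ => mul_nonneg (G.rate_nonneg _ y) (mul_self_nonneg _))
    (fun y _ => le_of_eq (by ring))
  have h2 := mul_le_mul_of_nonneg_right (hD (C.proj x)) (coverGamma_self_nonneg C f x)
  simp only [coverGamma, coverLaplacian] at *
  linarith

lemma coverGamma_le_of_abs_sub_le {D B : ℝ} (hD : ∀ v, ∑ y, G.rate v y ≤ D) {f : X → ℝ} {x : X}
    (hf : ∀ y, G.toSimpleGraph.Adj (C.proj x) y → |f (C.step x y) - f x| ≤ B) :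
    coverGamma C f f x ≤ D * B ^ 2 / 2 := by
  have : ∑ y, G.rate (C.proj x) y * ((f (C.step x y) - f x) * (f (C.step x y) - f x)) ≤
      ∑ y, G.rate (C.proj x) y * B ^ 2 := by
    refine Finset.sum_le_sum fun y _ => ?_
    by_cases hy : G.toSimpleGraph.Adj (C.proj x) y
    · refine mul_le_mul_of_nonneg_left ?_ (G.rate_nonneg _ y)
      rw [← sq, ← sq_abs]
      exact pow_le_pow_left₀ (abs_nonneg _) (hf y hy) 2
    · simp [G.rate_eq_zero hy]
  rw [← Finset.sum_mul] at this
  have h2 := mul_le_mul_of_nonneg_right (hD (C.proj x)) (sq_nonneg B)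
  simp only [coverGamma]
  linarith

lemma rate_mul_sq_le_coverGamma (f : X → ℝ) (x : X) (y : V) :
    G.rate (C.proj x) y * (f (C.step x y) - f x) ^ 2 ≤ 2 * coverGamma C f f x := by
  have h := Finset.single_le_sum (f := fun y =>
    G.rate (C.proj x) y * ((f (C.step x y) - f x) * (f (C.step x y) - f x)))
    (fun y _ => mul_nonneg (G.rate_nonneg _ y) (mul_self_nonneg _)) (Finset.mem_univ y)
  simp only [coverGamma] at *
  linarith

/-- Young's inequality on each edge. -/
lemma two_mul_coverGamma_le {ε : ℝ} (hε : 0 < ε) (f g : X → ℝ) (x : X) :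
    2 * coverGamma C f g x ≤ ε * coverGamma C f f x + ε⁻¹ * coverGamma C g g x := by
  simp only [coverGamma, Finset.mul_sum, ← Finset.sum_add_distrib]
  refine Finset.sum_le_sum fun y _ => ?_
  have hr := G.rate_nonneg (C.proj x) y
  generalize G.rate (C.proj x) y = r at *
  generalize f (C.step x y) - f x = a
  generalize g (C.step x y) - g x = b
  have h : 0 ≤ r * (ε * (a - ε⁻¹ * b) ^ 2) := by positivity
  have h2 : r * (ε * (a - ε⁻¹ * b) ^ 2) = r * (ε * a ^ 2 - 2 * (ε * ε⁻¹) * (a * b)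
    + (ε * ε⁻¹) * ε⁻¹ * b ^ 2) := by ring
  rw [mul_inv_cancel₀ hε.ne'] at h2
  linarith

lemma coverGamma_eq_of_laplacian_eq {u g : X → ℝ} {l : ℝ}
    (hu : ∀ x, coverLaplacian C u x = l * u x - g x) (x : X) :
    coverGamma C u (coverLaplacian C u) x = l * coverGamma C u u x - coverGamma C u g x := by
  simp only [coverGamma, hu]
  rw [mul_left_comm, ← mul_sub, Finset.mul_sum (a := l), ← Finset.sum_sub_distrib]
  congr 1
  exact Finset.sum_congr rfl fun y _ => by ring

/-- The gradient estimate for the resolvent, uniform in the spectral parameter `l`. -/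
theorem coverGamma_resolvent_le {ρ : V → ℝ} (hCD : G.CD ρ ⊤) {φ : V → ℝ} (hφ : ∀ x, 0 < φ x)
    (hφ1 : ∀ x, 2 * ρ x * φ x - G.laplacian φ x = 1) {Φ : ℝ} (hΦ : ∀ x, φ x ≤ Φ)
    {D : ℝ} (hD : ∀ v, ∑ y, G.rate v y ≤ D) {u g : X → ℝ} {B l A : ℝ} (hB : ∀ x, |u x| ≤ B)
    (hl : 0 ≤ l) (hu : ∀ x, coverLaplacian C u x = l * u x - g x)
    (hA : ∀ x, coverGamma C g g x ≤ A) (x : X) : coverGamma C u u x ≤ 4 * Φ ^ 2 * A := by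
  have : Nonempty X := ⟨x⟩
  have : Nonempty V := ⟨C.proj x⟩
  have hΦ0 : 0 < Φ := (hφ (C.proj x)).trans_le (hΦ _)
  have hB0 : 0 ≤ B := (abs_nonneg _).trans (hB x)
  have hD0 : 0 ≤ D := (Finset.sum_nonneg fun y _ => G.rate_nonneg (C.proj x) y).trans (hD _)
  let h : X → ℝ := fun x => coverGamma C u u x / φ (C.proj x)
  have hh : ∀ x, coverGamma C u u x = φ (C.proj x) * h x := fun x => by
    have := (hφ (C.proj x)).ne'
    simp only [h]; field_simp
  have hh0 : ∀ x, 0 ≤ h x := fun x => div_nonneg (coverGamma_self_nonneg C u x) (hφ _).le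
  obtain ⟨z, hz⟩ := Finite.exists_min φ
  -- This crude bound depends on `B` and serves only to make the supremum finite.
  have hbdd : BddAbove (Set.range h) := by
    refine ⟨D * (2 * B) ^ 2 / 2 / φ z, ?_⟩
    rintro _ ⟨x, rfl⟩
    refine div_le_div₀ (by positivity) ?_ (hφ z) (hz _)
    refine coverGamma_le_of_abs_sub_le C hD fun y _ => ?_
    exact (abs_sub _ _).trans (by linarith [hB x, hB (C.step x y)])
  set S := ⨆ x, h x with hS
  have hle : ∀ x, h x ≤ S := fun x => le_ciSup hbdd x
  -- The supremum `S` need not be attained on an infinite cover, so the maximum principle is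
  -- replaced by an inequality at every point with an error proportional to `S - h x`. The supremum
  -- is taken afterwards.
  have main : ∀ x, h x * (1 / 2 + D * Φ) ≤ D * Φ * S + 2 * Φ * A := by
    intro x
    have h1 := hCD.cover C u x
    rw [coverGamma_eq_of_laplacian_eq C hu] at h1
    -- With this `ε` the `Γ(u)` term costs at most `h x / 2`, half of the `h x` that the equation
    -- for `φ` provides.
    have h2 := two_mul_coverGamma_le C (ε := (2 * Φ)⁻¹) (by positivity) u g x
    rw [inv_inv] at h2
    -- The `l` term has a favourable sign and is dropped; hence the uniformity in `l`.
    have h3 := mul_nonneg hl (coverGamma_self_nonneg C u x)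
    have h4 : coverLaplacian C (coverGamma C u u) x ≤
        h x * G.laplacian φ (C.proj x) + D * (Φ * (S - h x)) := by
      have h5 : coverLaplacian C (coverGamma C u u) x ≤
          ∑ y, G.rate (C.proj x) y * (h x * (φ y - φ (C.proj x)) + Φ * (S - h x)) := by
        refine Finset.sum_le_sum fun y _ => ?_
        by_cases hy : G.toSimpleGraph.Adj (C.proj x) y
        · refine mul_le_mul_of_nonneg_left ?_ (G.rate_nonneg _ y)
          rw [hh, hh, C.proj_step x y hy]
          have h6 : φ y * h (C.step x y) ≤ φ y * S :=
            mul_le_mul_of_nonneg_left (hle _) (hφ y).le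
          have h7 : φ y * (S - h x) ≤ Φ * (S - h x) :=
            mul_le_mul_of_nonneg_right (hΦ y) (by linarith [hle x])
          linarith
        · simp [G.rate_eq_zero hy]
      refine h5.trans ?_
      simp only [mul_add, Finset.sum_add_distrib, ← Finset.sum_mul]
      refine add_le_add (le_of_eq ?_) (mul_le_mul_of_nonneg_right (hD _)
        (mul_nonneg hΦ0.le (by linarith [hle x])))
      rw [laplacian_apply, Finset.mul_sum]
      exact Finset.sum_congr rfl fun y _ => by ring
    have h8 : (2 * Φ)⁻¹ * coverGamma C u u x ≤ h x / 2 := by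
      rw [hh x]
      have : (2 * Φ)⁻¹ * (φ (C.proj x) * h x) ≤ (2 * Φ)⁻¹ * (Φ * h x) := by
        have := hh0 x
        have := hΦ (C.proj x)
        gcongr
      refine this.trans (le_of_eq ?_)
      field_simp
    have h9 : 2 * Φ * coverGamma C g g x ≤ 2 * Φ * A :=
      mul_le_mul_of_nonneg_left (hA x) (by positivity)
    have h10 : 2 * ρ (C.proj x) * coverGamma C u u x =
        h x + h x * G.laplacian φ (C.proj x) := by
      rw [hh x]
      linear_combination h x * hφ1 (C.proj x)
    linarith
  have hSle : S * (1 / 2 + D * Φ) ≤ D * Φ * S + 2 * Φ * A := by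
    rw [← le_div_iff₀ (by positivity)]
    exact ciSup_le fun x => (le_div_iff₀ (by positivity)).2 (main x)
  have hS2 : S ≤ 4 * Φ * A := by linarith
  have hS0 : 0 ≤ S := (hh0 x).trans (hle x)
  calc coverGamma C u u x = φ (C.proj x) * h x := hh x
    _ ≤ Φ * S := mul_le_mul (hΦ _) (hle x) (hh0 x) hΦ0.le
    _ ≤ Φ * (4 * Φ * A) := mul_le_mul_of_nonneg_left hS2 hΦ0.le
    _ = 4 * Φ ^ 2 * A := by ring

/-- The resolvent equation is solvable in bounded functions. -/
theorem exists_resolvent {D : ℝ} (hD : ∀ v, ∑ y, G.rate v y ≤ D) (hD0 : 0 ≤ D)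
    {l : ℝ} (hl : 0 < l) {g : X → ℝ} {B : ℝ} (hg : ∀ x, |g x| ≤ B) :
    ∃ (u : X → ℝ) (B' : ℝ), (∀ x, |u x| ≤ B') ∧ ∀ x, coverLaplacian C u x = l * u x - g x := by
  let _ : TopologicalSpace X := ⊥
  have : DiscreteTopology X := ⟨rfl⟩
  -- Adding `D * u` to both sides makes all coefficients on the right nonnegative with sum `D`, so
  -- `F` contracts the sup norm by `D / (l + D)`.
  let F : (X → ℝ) → X → ℝ := fun u x => (g x + D * u x + coverLaplacian C u x) / (l + D)
  have hlD : 0 < l + D := by linarith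
  have hcontr : ∀ (u v : X → ℝ) (M : ℝ), (∀ x, |u x - v x| ≤ M) → ∀ x,
      |F u x - F v x| ≤ D / (l + D) * M := by
    intro u v M hM x
    have hM0 : 0 ≤ M := (abs_nonneg _).trans (hM x)
    have e : F u x - F v x = ((D - ∑ y, G.rate (C.proj x) y) * (u x - v x) +
        ∑ y, G.rate (C.proj x) y * (u (C.step x y) - v (C.step x y))) / (l + D) := by
      simp only [F, coverLaplacian, mul_sub, Finset.sum_sub_distrib, ← Finset.sum_mul]
      ring
    rw [e, abs_div, abs_of_pos hlD, div_mul_eq_mul_div]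
    refine div_le_div_of_nonneg_right ?_ hlD.le
    have h1 : |(D - ∑ y, G.rate (C.proj x) y) * (u x - v x)| ≤
        (D - ∑ y, G.rate (C.proj x) y) * M := by
      rw [abs_mul, abs_of_nonneg (sub_nonneg.2 (hD _))]
      exact mul_le_mul_of_nonneg_left (hM x) (sub_nonneg.2 (hD _))
    have h2 : |∑ y, G.rate (C.proj x) y * (u (C.step x y) - v (C.step x y))| ≤
        (∑ y, G.rate (C.proj x) y) * M := by
      rw [Finset.sum_mul]
      refine (Finset.abs_sum_le_sum_abs _ _).trans (Finset.sum_le_sum fun y _ => ?_)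
      rw [abs_mul, abs_of_nonneg (G.rate_nonneg _ y)]
      exact mul_le_mul_of_nonneg_left (hM _) (G.rate_nonneg _ y)
    exact (abs_add_le _ _).trans (by linarith)
  have hF0 : ∀ x, |F 0 x| ≤ B / (l + D) := by
    intro x
    have : F 0 x = g x / (l + D) := by simp [F, coverLaplacian]
    rw [this, abs_div, abs_of_pos hlD]
    exact div_le_div_of_nonneg_right (hg x) hlD.le
  have hbound : ∀ u : BoundedContinuousFunction X ℝ, ∀ x,
      ‖F u x‖ ≤ D / (l + D) * ‖u‖ + B / (l + D) := by
    intro u x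
    have h1 := hcontr u 0 ‖u‖ (fun x => by simpa using u.norm_coe_le_norm x) x
    have h2 : F u x = (F u x - F 0 x) + F 0 x := by ring
    rw [Real.norm_eq_abs, h2]
    exact (abs_add_le _ _).trans (add_le_add h1 (hF0 x))
  let T : BoundedContinuousFunction X ℝ → BoundedContinuousFunction X ℝ := fun u =>
    BoundedContinuousFunction.ofNormedAddCommGroup (F u) continuous_of_discreteTopology _
      (hbound u)
  have hq : D / (l + D) < 1 := by rw [div_lt_one hlD]; linarith
  have hT : ContractingWith (D / (l + D)).toNNReal T := by
    refine ⟨Real.toNNReal_lt_one.2 hq, LipschitzWith.of_dist_le_mul fun u v => ?_⟩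
    rw [Real.coe_toNNReal _ (div_nonneg hD0 hlD.le),
      BoundedContinuousFunction.dist_le (by positivity)]
    intro x
    rw [Real.dist_eq]
    refine hcontr u v (dist u v) (fun x => ?_) x
    rw [← Real.dist_eq]
    exact BoundedContinuousFunction.dist_coe_le_dist x
  let u := ContractingWith.fixedPoint T hT
  have hu : T u = u := hT.fixedPoint_isFixedPt
  refine ⟨u, ‖u‖, fun x => u.norm_coe_le_norm x, fun x => ?_⟩
  have h1 : F u x = u x := DFunLike.congr_fun hu x
  simp only [F] at h1
  rw [div_eq_iff hlD.ne'] at h1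
  linarith

/-- **Diameter bound.** A cover of a finite connected graph with nonnegative curvature that is
positive somewhere is finite, if all its points are reached from a single one. -/
theorem finite_cover (hconn : G.toSimpleGraph.Connected) {ρ : V → ℝ} (hCD : G.CD ρ ⊤)
    (hnonneg : ∀ x, 0 ≤ ρ x) (hpos : ∃ x, 0 < ρ x) (x₀ : X)
    (hreach : ∀ x, ∃ n, C.Reaches x₀ n x) : Finite X := by
  classical
  have := hconn.nonempty
  obtain ⟨φ, hφ, hφ1⟩ := G.exists_pos_solution hconn hnonneg hpos
  obtain ⟨zΦ, hΦ⟩ := Finite.exists_max φ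
  obtain ⟨zD, hD⟩ := Finite.exists_max fun v => ∑ y, G.rate v y
  set Φ := φ zΦ
  set D := ∑ y, G.rate zD y
  have hΦ0 : 0 < Φ := hφ _
  have hD0 : 0 ≤ D := Finset.sum_nonneg fun y _ => G.rate_nonneg _ y
  let d : X → ℕ := fun x => Nat.find (hreach x)
  have hd : ∀ x, C.Reaches x₀ (d x) x := fun x => Nat.find_spec (hreach x)
  have hdmin : ∀ {x n}, C.Reaches x₀ n x → d x ≤ n := fun h => Nat.find_min' _ h
  have hd0 : d x₀ = 0 := Nat.le_zero.1 (hdmin .zero)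
  have hstep : ∀ x y, G.toSimpleGraph.Adj (C.proj x) y → d (C.step x y) ≤ d x + 1 :=
    fun x y hy => hdmin ((hd x).succ hy)
  have hstep' : ∀ x y, G.toSimpleGraph.Adj (C.proj x) y → d x ≤ d (C.step x y) + 1 := by
    intro x y hy
    have := hstep (C.step x y) (C.proj x) (by rw [C.proj_step x y hy]; exact hy.symm)
    rwa [C.step_back x y hy] at this
  -- This is `4 * Φ ^ 2 * A` with `A = D / 2`, the bound on `Γ(g)` for a `1`-Lipschitz `g`.
  let E : ℝ := 2 * Φ ^ 2 * D
  have hE0 : 0 ≤ E := by positivity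
  -- A Lipschitz constant for `u`: it dominates every `2 * E / G.rate x y`, and `K ≤ K ^ 2` thanks
  -- to the summand `1`. Non-adjacent pairs contribute `0`, by division by zero.
  let K : ℝ := 1 + ∑ x, ∑ y, 2 * E / G.rate x y
  have hKs : ∀ x y, 0 ≤ 2 * E / G.rate x y := fun x y =>
    div_nonneg (by positivity) (G.rate_nonneg x y)
  have hK1 : 1 ≤ K := le_add_of_nonneg_right
    (Finset.sum_nonneg fun x _ => Finset.sum_nonneg fun y _ => hKs x y)
  have hK : ∀ x y, 2 * E / G.rate x y ≤ K := fun x y =>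
    ((Finset.single_le_sum (f := fun y => 2 * E / G.rate x y) (fun y _ => hKs x y)
      (Finset.mem_univ y)).trans (Finset.single_le_sum
        (f := fun x => ∑ y, 2 * E / G.rate x y)
        (fun x _ => Finset.sum_nonneg fun y _ => hKs x y) (Finset.mem_univ x))).trans
      (le_add_of_nonneg_left zero_le_one)
  have hdiam : ∀ x, (d x : ℝ) ≤ 4 * Φ * D + 1 := by
    intro x
    set n := d x with hn
    let g : X → ℝ := fun z => min (d z : ℝ) n
    have hgB : ∀ z, |g z| ≤ n := fun z => by
      rw [abs_of_nonneg (by positivity)]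
      exact min_le_right _ _
    have hgL : ∀ z y, G.toSimpleGraph.Adj (C.proj z) y → |g (C.step z y) - g z| ≤ 1 := by
      intro z y hy
      have h1 : (d (C.step z y) : ℝ) ≤ d z + 1 := by exact_mod_cast hstep z y hy
      have h2 : (d z : ℝ) ≤ d (C.step z y) + 1 := by exact_mod_cast hstep' z y hy
      refine (abs_min_sub_min_le_max _ _ _ _).trans (max_le ?_ (by simp))
      rw [abs_le]
      constructor <;> linarith
    have hgA : ∀ z, coverGamma C g g z ≤ D / 2 := fun z => by
      have := coverGamma_le_of_abs_sub_le C hD (hgL z)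
      simpa using this
    have hK0 : 0 < K := by linarith
    -- Small enough that `l * u` varies by at most `1` along a walk of length `n`.
    set l : ℝ := (n * K + 1)⁻¹ with hl
    have hl0 : 0 < l := by positivity
    obtain ⟨u, B, hB, hu⟩ := exists_resolvent C hD hD0 hl0 hgB
    have hgrad : ∀ z, coverGamma C u u z ≤ E := fun z =>
      (coverGamma_resolvent_le C hCD hφ hφ1 hΦ hD hB hl0.le hu hgA z).trans
        (le_of_eq (by ring))
    have hlap : ∀ z, |l * u z - g z| ≤ 2 * Φ * D := by
      intro z
      refine abs_le_of_sq_le_sq ?_ (by positivity)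
      rw [← hu z]
      calc _ ≤ 2 * D * coverGamma C u u z := coverLaplacian_sq_le C hD u z
        _ ≤ 2 * D * E := mul_le_mul_of_nonneg_left (hgrad z) (by positivity)
        _ = (2 * Φ * D) ^ 2 := by ring
    have huL : ∀ z y, G.toSimpleGraph.Adj (C.proj z) y → |u (C.step z y) - u z| ≤ K := by
      intro z y hy
      have hr := G.rate_pos hy
      refine abs_le_of_sq_le_sq ?_ hK0.le
      have h1 := (rate_mul_sq_le_coverGamma C u z y).trans
        (mul_le_mul_of_nonneg_left (hgrad z) zero_le_two)
      rw [mul_comm, ← le_div_iff₀ hr] at h1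
      nlinarith [hK (C.proj z) y]
    have hosc : l * |u x - u x₀| ≤ 1 := by
      refine (mul_le_mul_of_nonneg_left ((hd x).abs_sub_le C huL) hl0.le).trans ?_
      rw [hl, inv_mul_le_iff₀ (by positivity)]
      linarith
    have hg0 : g x₀ = 0 := by simp [g, hd0]
    have hgx : g x = n := by simp [g, hn]
    have e : l * |u x - u x₀| = |l * u x - l * u x₀| := by
      rw [← mul_sub, abs_mul, abs_of_pos hl0]
    rw [e] at hosc
    have h1 := abs_le.1 hosc
    have h2 := abs_le.1 (hlap x)
    have h3 := abs_le.1 (hlap x₀)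
    rw [hgx] at h2
    rw [hg0] at h3
    linarith
  obtain ⟨N, hN⟩ := exists_nat_ge (4 * Φ * D + 1)
  have hfin : (⋃ n ∈ Set.Iic N, {x | C.Reaches x₀ n x}).Finite :=
    (Set.finite_Iic N).biUnion fun n _ => C.finite_setOf_reaches x₀ n
  refine Set.finite_univ_iff.1 (hfin.subset fun x _ => ?_)
  simp only [Set.mem_iUnion]
  exact ⟨d x, by exact_mod_cast (hdiam x).trans hN, hd x⟩

end MeasuredWeightedGraph

/-! ### Homotopy classes of paths confined to a subset -/

namespace Path.Homotopic.Quotient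

variable {E : Type*} [TopologicalSpace E] {K : Set E}

/-- The homotopy class `α` in `K` has a representative that stays in `S`. -/
def Within (S : Set E) {p q : K} (α : Path.Homotopic.Quotient p q) : Prop :=
  ∃ γ : Path p q, α = mk γ ∧ ∀ t, (γ t : E) ∈ S

variable {S T : Set E} {p q r : K}

lemma Within.mono (hST : S ⊆ T) {α : Path.Homotopic.Quotient p q} (h : α.Within S) :
    α.Within T := by
  obtain ⟨γ, rfl, hγ⟩ := h
  exact ⟨γ, rfl, fun t => hST (hγ t)⟩

lemma within_refl (hp : (p : E) ∈ S) : (refl p).Within S :=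
  ⟨Path.refl p, rfl, fun _ => hp⟩

lemma Within.trans {α : Path.Homotopic.Quotient p q} {β : Path.Homotopic.Quotient q r}
    (hα : α.Within S) (hβ : β.Within S) : (α.trans β).Within S := by
  obtain ⟨γ, rfl, hγ⟩ := hα
  obtain ⟨δ, rfl, hδ⟩ := hβ
  refine ⟨γ.trans δ, rfl, fun t => ?_⟩
  rw [Path.trans_apply]
  split_ifs
  · exact hγ _
  · exact hδ _

lemma Within.source_mem {α : Path.Homotopic.Quotient p q} (h : α.Within S) : (p : E) ∈ S := by
  obtain ⟨γ, -, hγ⟩ := h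
  simpa using hγ 0

variable {E : Type*} [AddCommGroup E] [Module ℝ E] [TopologicalSpace E] [ContinuousAdd E]
  [ContinuousSMul ℝ E] {K S : Set E} {p q : K}

/-- Two homotopy classes with representatives in a common star convex subset agree. -/
lemma Within.eq {c : E} (hS : StarConvex ℝ c S) (hSK : S ⊆ K)
    {α β : Path.Homotopic.Quotient p q} (hα : α.Within S) (hβ : β.Within S) : α = β := by
  have hp := hα.source_mem
  obtain ⟨γ, rfl, hγ⟩ := hα
  obtain ⟨δ, rfl, hδ⟩ := hβ
  have hq : (q : E) ∈ S := by simpa using hγ 1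
  have : ContractibleSpace S := hS.contractibleSpace ⟨p, hp⟩
  let lift : ∀ η : Path p q, (∀ t, (η t : E) ∈ S) → Path (⟨p, hp⟩ : S) ⟨q, hq⟩ := fun η hη =>
    { toFun := fun t => ⟨η t, hη t⟩
      continuous_toFun := by fun_prop
      source' := by simp
      target' := by simp }
  let f : C(S, K) := ⟨Set.inclusion hSK, continuous_inclusion hSK⟩
  -- The homotopy exists inside the contractible set `S` and is pushed forward to `K`.
  have h := (SimplyConnectedSpace.paths_homotopic (lift γ hγ) (lift δ hδ)).map f
  exact Path.Homotopic.Quotient.eq.2 h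

lemma exists_within (hS : segment ℝ (p : E) q ⊆ S) (hSK : S ⊆ K) :
    ∃ α : Path.Homotopic.Quotient p q, α.Within S := by
  have h := JoinedIn.of_segment_subset hS
  refine ⟨mk { toFun := fun t => ⟨h.somePath t, hSK (h.somePath_mem t)⟩,
               continuous_toFun := by fun_prop
               source' := by simp
               target' := by simp }, _, rfl, fun t => h.somePath_mem t⟩

end Path.Homotopic.Quotient

/-! ### Faces, stars and edge paths of the filled complex -/

namespace SimpleGraph

open Path.Homotopic.Quotient

variable {V : Type*} (G : SimpleGraph V)

/-- The vertex sets of the closed cells of the triangulation of `filledComplex`. -/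
def IsFace (F : Set (V ⊕ Set (Sym2 V))) : Prop :=
  (∃ a, F = {Sum.inl a}) ∨ (∃ a b, G.Adj a b ∧ F = {Sum.inl a, Sum.inl b}) ∨
    ∃ c a b, G.IsShortCycle c ∧ s(a, b) ∈ c ∧ F = {Sum.inl a, Sum.inl b, Sum.inr c}

/-- The simplex spanned by a set of vertices. -/
def faceHull (F : Set (V ⊕ Set (Sym2 V))) : Set (V ⊕ Set (Sym2 V) → ℝ) :=
  convexHull ℝ (basisPoint '' F)

/-- The union of the faces containing `i`. -/
def closedStar (i : V ⊕ Set (Sym2 V)) : Set (V ⊕ Set (Sym2 V) → ℝ) :=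
  {p | ∃ F, G.IsFace F ∧ i ∈ F ∧ p ∈ faceHull F}

variable {G}

lemma basisPoint_mem_faceHull {F : Set (V ⊕ Set (Sym2 V))} {i : V ⊕ Set (Sym2 V)} (h : i ∈ F) :
    basisPoint i ∈ faceHull F :=
  subset_convexHull _ _ ⟨i, h, rfl⟩

lemma faceHull_mono {F F' : Set (V ⊕ Set (Sym2 V))} (h : F ⊆ F') : faceHull F ⊆ faceHull F' :=
  convexHull_mono (Set.image_mono h)

lemma convex_faceHull (F : Set (V ⊕ Set (Sym2 V))) : Convex ℝ (faceHull F) :=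
  convex_convexHull _ _

/-- The coordinate at `i` vanishes on all corners of a face that misses `i`. Thus points with
positive `i`-th coordinate form the open star of `i`. -/
lemma mem_of_mem_faceHull {F : Set (V ⊕ Set (Sym2 V))} {i : V ⊕ Set (Sym2 V)}
    {p : V ⊕ Set (Sym2 V) → ℝ} (hp : p ∈ faceHull F) (hi : p i ≠ 0) : i ∈ F := by
  classical
  by_contra hiF
  refine hi ?_
  have hconv : Convex ℝ {q : V ⊕ Set (Sym2 V) → ℝ | q i = 0} := by
    intro x hx y hy a b _ _ _
    simp only [Set.mem_ofPred_eq] at hx hy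
    simp [hx, hy]
  refine convexHull_min ?_ hconv hp
  rintro _ ⟨j, hj, rfl⟩
  have : i ≠ j := fun h => hiF (h ▸ hj)
  simp [basisPoint, this]

/-- Barycentric coordinates sum to one; hence the open stars cover the complex. -/
lemma exists_pos_of_mem_faceHull [Finite V] {F : Set (V ⊕ Set (Sym2 V))}
    {p : V ⊕ Set (Sym2 V) → ℝ} (hp : p ∈ faceHull F) : ∃ i, 0 < p i := by
  classical
  have := Fintype.ofFinite (V ⊕ Set (Sym2 V))
  have h : p ∈ stdSimplex ℝ (V ⊕ Set (Sym2 V)) := by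
    refine convexHull_min ?_ (convex_stdSimplex ℝ _) hp
    rintro _ ⟨j, -, rfl⟩
    unfold basisPoint
    convert! single_mem_stdSimplex ℝ j
  by_contra! hcon
  have := Finset.sum_nonpos fun i (_ : i ∈ Finset.univ) => hcon i
  rw [h.2] at this
  linarith

lemma starConvex_closedStar (i : V ⊕ Set (Sym2 V)) :
    StarConvex ℝ (basisPoint i) (G.closedStar i) := by
  rintro p ⟨F, hF, hi, hp⟩ a b ha hb hab
  exact ⟨F, hF, hi, convex_faceHull F (basisPoint_mem_faceHull hi) hp ha hb hab⟩

lemma faceHull_subset_closedStar {F : Set (V ⊕ Set (Sym2 V))} (hF : G.IsFace F)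
    {i : V ⊕ Set (Sym2 V)} (hi : i ∈ F) : faceHull F ⊆ G.closedStar i :=
  fun _ hp => ⟨F, hF, hi, hp⟩

lemma IsShortCycle.adj {c : Set (Sym2 V)} (hc : G.IsShortCycle c) {a b : V} (h : s(a, b) ∈ c) :
    G.Adj a b := by
  obtain ⟨v, p, -, -, rfl⟩ := hc
  exact p.adj_of_mem_edges h

lemma IsFace.adj {F : Set (V ⊕ Set (Sym2 V))} (hF : G.IsFace F) {a b : V}
    (ha : Sum.inl a ∈ F) (hb : Sum.inl b ∈ F) (hab : a ≠ b) : G.Adj a b := by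
  have key : ∀ {x y : V}, G.Adj x y → (a = x ∨ a = y) → (b = x ∨ b = y) → G.Adj a b := by
    rintro x y h (rfl | rfl) (rfl | rfl)
    exacts [absurd rfl hab, h, h.symm, absurd rfl hab]
  rcases hF with ⟨x, rfl⟩ | ⟨x, y, h, rfl⟩ | ⟨c, x, y, hc, h, rfl⟩
  · simp only [Set.mem_singleton_iff, Sum.inl.injEq] at ha hb
    exact absurd (ha.trans hb.symm) hab
  · exact key h (by simpa using ha) (by simpa using hb)
  · exact key (hc.adj h) (by simpa using ha) (by simpa using hb)

lemma IsFace.exists_vertex {F : Set (V ⊕ Set (Sym2 V))} (hF : G.IsFace F) :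
    ∃ a, Sum.inl a ∈ F := by
  rcases hF with ⟨x, rfl⟩ | ⟨x, y, h, rfl⟩ | ⟨c, x, y, hc, h, rfl⟩ <;> exact ⟨x, by simp⟩

lemma IsFace.isShortCycle {F : Set (V ⊕ Set (Sym2 V))} (hF : G.IsFace F) {c : Set (Sym2 V)}
    (hc : Sum.inr c ∈ F) : G.IsShortCycle c ∧ ∀ a, Sum.inl a ∈ F → ∃ b, s(a, b) ∈ c := by
  rcases hF with ⟨x, rfl⟩ | ⟨x, y, h, rfl⟩ | ⟨c', x, y, hc', h, rfl⟩
  · simp at hc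
  · simp at hc
  · obtain rfl : c = c' := by simpa using hc
    refine ⟨hc', fun a ha => ?_⟩
    have ha' : a = x ∨ a = y := by simpa using ha
    rcases ha' with rfl | rfl
    · exact ⟨y, h⟩
    · exact ⟨x, by rwa [Sym2.eq_swap]⟩

lemma isFace_singleton (a : V) : G.IsFace {Sum.inl a} := Or.inl ⟨a, rfl⟩

lemma isFace_pair {a b : V} (h : G.Adj a b) : G.IsFace {Sum.inl a, Sum.inl b} :=
  Or.inr (Or.inl ⟨a, b, h, rfl⟩)

lemma isShortCycle_triangle {a b c : V} (hab : G.Adj a b) (hbc : G.Adj b c) (hca : G.Adj c a) :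
    G.IsShortCycle {s(a, b), s(b, c), s(c, a)} := by
  refine ⟨a, .cons hab (.cons hbc (.cons hca .nil)), ?_, Or.inl rfl, ?_⟩
  · rw [Walk.cons_isCycle_iff]
    have h1 := hab.ne
    have h2 := hbc.ne
    have h3 := hca.ne
    simp [Walk.cons_isPath_iff, *, Ne.symm]
  · ext e
    simp [Walk.edgeSet]

lemma isShortCycle_square {a b c d : V} (hab : G.Adj a b) (hbc : G.Adj b c) (hcd : G.Adj c d)
    (hda : G.Adj d a) (hac : a ≠ c) (hbd : b ≠ d) :
    G.IsShortCycle {s(a, b), s(b, c), s(c, d), s(d, a)} := by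
  refine ⟨a, .cons hab (.cons hbc (.cons hcd (.cons hda .nil))), ?_, Or.inr rfl, ?_⟩
  · rw [Walk.cons_isCycle_iff]
    have h1 := hab.ne
    have h2 := hbc.ne
    have h3 := hcd.ne
    have h4 := hda.ne
    simp [Walk.cons_isPath_iff, *, Ne.symm]
  · ext e
    simp [Walk.edgeSet]

variable [Finite V]

lemma mem_filledComplex_iff {p : V ⊕ Set (Sym2 V) → ℝ} :
    p ∈ G.filledComplex ↔ ∃ F, G.IsFace F ∧ p ∈ faceHull F := by
  constructor
  · rintro ((⟨v, rfl⟩ | ⟨a, b, h, hp⟩) | ⟨c, a, b, hc, h, hp⟩)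
    · exact ⟨_, isFace_singleton v, basisPoint_mem_faceHull rfl⟩
    · refine ⟨_, isFace_pair h, ?_⟩
      rwa [faceHull, Set.image_pair, convexHull_pair]
    · refine ⟨_, Or.inr (Or.inr ⟨c, a, b, hc, h, rfl⟩), ?_⟩
      rwa [faceHull, Set.image_insert_eq, Set.image_pair]
  · rintro ⟨F, ⟨x, rfl⟩ | ⟨x, y, h, rfl⟩ | ⟨c, x, y, hc, h, rfl⟩, hp⟩
    · refine Or.inl (Or.inl ⟨x, ?_⟩)
      simpa [faceHull] using hp
    · refine Or.inl (Or.inr ⟨x, y, h, ?_⟩)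
      rwa [faceHull, Set.image_pair, convexHull_pair] at hp
    · refine Or.inr ⟨c, x, y, hc, h, ?_⟩
      rwa [faceHull, Set.image_insert_eq, Set.image_pair] at hp

lemma faceHull_subset_filledComplex {F : Set (V ⊕ Set (Sym2 V))} (hF : G.IsFace F) :
    faceHull F ⊆ G.filledComplex :=
  fun _ hp => mem_filledComplex_iff.2 ⟨F, hF, hp⟩

lemma closedStar_subset_filledComplex (i : V ⊕ Set (Sym2 V)) :
    G.closedStar i ⊆ G.filledComplex := by
  rintro p ⟨F, hF, -, hp⟩
  exact faceHull_subset_filledComplex hF hp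

variable (G) in
/-- The vertex `a` as a point of the complex. -/
noncomputable def vertexPoint (a : V) : G.filledComplex :=
  ⟨basisPoint (Sum.inl a), Or.inl (Or.inl ⟨a, rfl⟩)⟩

lemma exists_within_face {F : Set (V ⊕ Set (Sym2 V))} (hF : G.IsFace F) {a : V}
    (ha : Sum.inl a ∈ F) {p : G.filledComplex} (hp : (p : V ⊕ Set (Sym2 V) → ℝ) ∈ faceHull F) :
    ∃ α : Path.Homotopic.Quotient p (G.vertexPoint a), α.Within (faceHull F) :=
  exists_within ((convex_faceHull F).segment_subset hp (basisPoint_mem_faceHull ha))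
    (faceHull_subset_filledComplex hF)

lemma exists_edgeClass {a b : V} (h : G.Adj a b) :
    ∃ α : Path.Homotopic.Quotient (G.vertexPoint a) (G.vertexPoint b),
      α.Within (faceHull {Sum.inl a, Sum.inl b}) :=
  exists_within_face (isFace_pair h) (by simp) (basisPoint_mem_faceHull (by simp))

/-- The homotopy class of the edge from `a` to `b`. -/
noncomputable def edgeClass {a b : V} (h : G.Adj a b) :
    Path.Homotopic.Quotient (G.vertexPoint a) (G.vertexPoint b) :=
  (exists_edgeClass h).choose

lemma edgeClass_within {a b : V} (h : G.Adj a b) :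
    (edgeClass h).Within (faceHull {Sum.inl a, Sum.inl b}) :=
  (exists_edgeClass h).choose_spec

lemma edgeClass_within_face {F : Set (V ⊕ Set (Sym2 V))} {a b : V} (h : G.Adj a b)
    (ha : Sum.inl a ∈ F) (hb : Sum.inl b ∈ F) : (edgeClass h).Within (faceHull F) :=
  (edgeClass_within h).mono (faceHull_mono (by rintro _ (rfl | rfl) <;> assumption))

lemma edgeClass_within_closedStar {c : Set (Sym2 V)} (hc : G.IsShortCycle c) {a b : V}
    (h : G.Adj a b) (hab : s(a, b) ∈ c) :
    (edgeClass h).Within (G.closedStar (Sum.inr c)) :=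
  (edgeClass_within_face h (F := {Sum.inl a, Sum.inl b, Sum.inr c}) (by simp) (by simp)).mono
    (faceHull_subset_closedStar (Or.inr (Or.inr ⟨c, a, b, hc, hab, rfl⟩)) (by simp))

/-- The homotopy classes of edge paths starting at `a`. -/
inductive IsEdgePath (a : V) :
    ∀ b, Path.Homotopic.Quotient (G.vertexPoint a) (G.vertexPoint b) → Prop
  | nil : IsEdgePath a a (Path.Homotopic.Quotient.refl _)
  | snoc {b c : V} {α : Path.Homotopic.Quotient (G.vertexPoint a) (G.vertexPoint b)} :
      IsEdgePath a b α → ∀ h : G.Adj b c, IsEdgePath a c (α.trans (edgeClass h))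

lemma isEdgePath_edgeClass {a b : V} (h : G.Adj a b) : IsEdgePath a b (edgeClass h) := by
  simpa using IsEdgePath.nil.snoc h

lemma IsEdgePath.trans {a b c : V}
    {α : Path.Homotopic.Quotient (G.vertexPoint a) (G.vertexPoint b)}
    {β : Path.Homotopic.Quotient (G.vertexPoint b) (G.vertexPoint c)}
    (hα : IsEdgePath a b α) (hβ : IsEdgePath b c β) : IsEdgePath a c (α.trans β) := by
  induction hβ with
  | nil => simpa using hα
  | snoc _ h ih =>
    rw [← trans_assoc]
    exact ih.snoc h

/-- A walk along a short cycle gives an edge path in the disk filling it. -/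
lemma exists_isEdgePath_of_walk {c : Set (Sym2 V)} (hc : G.IsShortCycle c) {a b : V}
    (p : G.Walk a b) (ha : basisPoint (Sum.inl a) ∈ G.closedStar (Sum.inr c))
    (hp : ∀ e ∈ p.edges, e ∈ c) :
    ∃ α : Path.Homotopic.Quotient (G.vertexPoint a) (G.vertexPoint b),
      IsEdgePath a b α ∧ α.Within (G.closedStar (Sum.inr c)) := by
  induction p with
  | nil => exact ⟨_, .nil, within_refl ha⟩
  | cons h p ih =>
    have h1 := hp s(_, _) (by rw [Walk.edges_cons]; exact List.mem_cons_self)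
    obtain ⟨α, hα, hαw⟩ := ih ⟨_, Or.inr (Or.inr ⟨c, _, _, hc, h1, rfl⟩), by simp,
      basisPoint_mem_faceHull (by simp)⟩ fun e he => hp e (by simp [he])
    exact ⟨_, (isEdgePath_edgeClass h).trans hα, (edgeClass_within_closedStar hc h h1).trans hαw⟩

lemma IsShortCycle.exists_isEdgePath {c : Set (Sym2 V)} (hc : G.IsShortCycle c) {a a' b b' : V}
    (ha : s(a, a') ∈ c) (hb : s(b, b') ∈ c) :
    ∃ α : Path.Homotopic.Quotient (G.vertexPoint a) (G.vertexPoint b),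
      IsEdgePath a b α ∧ α.Within (G.closedStar (Sum.inr c)) := by
  classical
  have hc' := hc
  obtain ⟨v, p, -, -, rfl⟩ := hc'
  have ha' : a ∈ p.support := p.fst_mem_support_of_mem_edges ha
  have hb' : b ∈ p.support := p.fst_mem_support_of_mem_edges hb
  -- Go back along the cycle from `a` to its base vertex, then forward to `b`.
  refine exists_isEdgePath_of_walk hc ((p.takeUntil a ha').reverse.append (p.takeUntil b hb'))
    ⟨_, Or.inr (Or.inr ⟨_, _, _, hc, ha, rfl⟩), by simp, basisPoint_mem_faceHull (by simp)⟩ ?_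
  intro e he
  rw [Walk.edges_append, Walk.edges_reverse, List.mem_append, List.mem_reverse] at he
  rcases he with he | he
  · exact p.edges_takeUntil_subset_edges ha' he
  · exact p.edges_takeUntil_subset_edges hb' he

/-- Two faces with a common vertex `i` are joined by an edge path in the closed star of `i`. -/
lemma exists_isEdgePath_closedStar {F F' : Set (V ⊕ Set (Sym2 V))} (hF : G.IsFace F)
    (hF' : G.IsFace F') {i : V ⊕ Set (Sym2 V)} (hi : i ∈ F) (hi' : i ∈ F') {b : V}
    (hb : Sum.inl b ∈ F) : ∃ a, Sum.inl a ∈ F' ∧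
      ∃ α : Path.Homotopic.Quotient (G.vertexPoint a) (G.vertexPoint b), IsEdgePath a b α ∧
        α.Within (G.closedStar i) := by
  rcases i with a | c
  · refine ⟨a, hi', ?_⟩
    by_cases hab : a = b
    · subst hab
      exact ⟨_, .nil, within_refl ⟨F, hF, hi, basisPoint_mem_faceHull hi⟩⟩
    · have h := hF.adj hi hb hab
      exact ⟨_, isEdgePath_edgeClass h,
        (edgeClass_within_face h hi hb).mono (faceHull_subset_closedStar hF hi)⟩
  · obtain ⟨a, ha⟩ := hF'.exists_vertex
    obtain ⟨a', haa⟩ := (hF'.isShortCycle hi').2 a ha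
    obtain ⟨b', hbb⟩ := (hF.isShortCycle hi).2 b hb
    exact ⟨a, ha, (hF.isShortCycle hi).1.exists_isEdgePath haa hbb⟩

/-! ### Deforming paths to edge paths -/

/-- The class `α` runs from `p` within a face to a vertex, and then along edges. -/
def IsAnchor {p : G.filledComplex} {b : V}
    (α : Path.Homotopic.Quotient p (G.vertexPoint b)) : Prop :=
  ∃ F, G.IsFace F ∧ ∃ a, Sum.inl a ∈ F ∧
    ∃ (δ : Path.Homotopic.Quotient p (G.vertexPoint a)) (β : _),
      δ.Within (faceHull F) ∧ IsEdgePath a b β ∧ α = δ.trans β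

/-- Composition with `γ` preserves the anchors. -/
def PreservesAnchors {p q : G.filledComplex} (γ : Path.Homotopic.Quotient p q) : Prop :=
  ∀ (b : V) (α : Path.Homotopic.Quotient q (G.vertexPoint b)), IsAnchor α → IsAnchor (γ.trans α)

/-- A path in the open star of `i` starts and ends in faces containing `i`. An edge path in the
closed star joins vertices of these faces, and the two routes are homotopic since the closed star is
star convex. -/
lemma preservesAnchors_of_pos {p q : G.filledComplex} (γ : _root_.Path p q) (i : V ⊕ Set (Sym2 V))
    (hγ : ∀ t, 0 < (γ t : V ⊕ Set (Sym2 V) → ℝ) i) :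
    PreservesAnchors (Path.Homotopic.Quotient.mk γ) := by
  rintro b α ⟨F, hF, u, hu, δ, β, hδ, hβ, rfl⟩
  have hi : i ∈ F := by
    refine mem_of_mem_faceHull hδ.source_mem (ne_of_gt ?_)
    simpa using hγ 1
  have hstar : ∀ t, (γ t : V ⊕ Set (Sym2 V) → ℝ) ∈ G.closedStar i := fun t => by
    obtain ⟨F', hF', h⟩ := mem_filledComplex_iff.1 (γ t).2
    exact ⟨F', hF', mem_of_mem_faceHull h (hγ t).ne', h⟩
  obtain ⟨F', hF', hi', hp⟩ := hstar 0
  rw [γ.source] at hp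
  obtain ⟨a, ha, ω, hω, hωw⟩ := exists_isEdgePath_closedStar hF hF' hi hi' hu
  obtain ⟨δ', hδ'⟩ := exists_within_face hF' ha hp
  refine ⟨F', hF', a, ha, δ', _, hδ', hω.trans hβ, ?_⟩
  rw [← trans_assoc, ← trans_assoc]
  congr 1
  refine Within.eq (starConvex_closedStar i) (closedStar_subset_filledComplex i)
    (Within.trans ⟨γ, rfl, hstar⟩ (hδ.mono (faceHull_subset_closedStar hF hi)))
    ((hδ'.mono (faceHull_subset_closedStar hF' hi')).trans hωw)

/-- Subdivide the path so that each piece lies in one open star, and prepend the pieces to the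
anchor from the last to the first. -/
lemma preservesAnchors {p q : G.filledComplex} (γ : _root_.Path p q) :
    PreservesAnchors (Path.Homotopic.Quotient.mk γ) := by
  obtain ⟨t, ht0, htm, ⟨m, hm⟩, ht⟩ := exists_monotone_Icc_subset_open_cover_unitInterval
    (c := fun i => {s | 0 < (γ s : V ⊕ Set (Sym2 V) → ℝ) i})
    (fun i => isOpen_lt continuous_const
      ((continuous_apply i).comp (continuous_subtype_val.comp γ.continuous)))
    (fun s _ => by
      obtain ⟨F, -, hF⟩ := mem_filledComplex_iff.1 (γ s).2
      exact Set.mem_iUnion.2 (exists_pos_of_mem_faceHull hF))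
  have key : ∀ n, PreservesAnchors (Path.Homotopic.Quotient.mk (γ.subpath (t 0) (t n))) := by
    intro n
    induction n with
    | zero =>
      intro b α hα
      rw [Path.subpath_self, mk_refl, refl_trans]
      exact hα
    | succ n ih =>
      obtain ⟨i, hi⟩ := ht n
      have h := preservesAnchors_of_pos (γ.subpath (t n) (t (n + 1))) i fun s => by
        have hs : γ.subpath (t n) (t (n + 1)) s ∈ γ '' Set.Icc (t n) (t (n + 1)) := by
          rw [← Path.range_subpath_of_le _ _ _ (htm n.le_succ)]
          exact Set.mem_range_self s
        obtain ⟨r, hr, hrs⟩ := hs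
        rw [← hrs]
        exact hi hr
      intro b α hα
      rw [← Path.Homotopic.Quotient.eq.2
        ⟨Path.Homotopy.subpathTransSubpath γ (t 0) (t n) (t (n + 1))⟩, mk_trans, trans_assoc]
      exact ih b _ (h b α hα)
  have h := key m
  rw [ht0, hm m le_rfl, Path.subpath_zero_one] at h
  -- The subpath from `0` to `1` is `γ` only up to a cast of its endpoints.
  have hcast : ∀ {p' q' : G.filledComplex} (hp : p' = p) (hq : q' = q),
      PreservesAnchors (Path.Homotopic.Quotient.mk (γ.cast hp hq)) →
      PreservesAnchors (Path.Homotopic.Quotient.mk γ) := by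
    rintro _ _ rfl rfl h
    exact h
  exact hcast _ _ h

/-- Every path between vertices is homotopic to an edge path. -/
theorem isEdgePath {a b : V} (α : Path.Homotopic.Quotient (G.vertexPoint a) (G.vertexPoint b)) :
    IsEdgePath a b α := by
  induction α using Path.Homotopic.Quotient.ind with | mk γ =>
  have hb : IsAnchor (Path.Homotopic.Quotient.refl (G.vertexPoint b)) :=
    ⟨_, isFace_singleton b, b, rfl, .refl _, .refl _,
      within_refl (basisPoint_mem_faceHull rfl), .nil, by simp⟩
  obtain ⟨F, hF, u, hu, δ, β, hδ, hβ, h⟩ := preservesAnchors γ b _ hb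
  rw [trans_refl] at h
  rw [h]
  refine IsEdgePath.trans ?_ hβ
  -- The start is a vertex, so it is a corner of `F`, and the initial segment `δ` is trivial or an
  -- edge.
  have ha : Sum.inl a ∈ F := mem_of_mem_faceHull hδ.source_mem (by
    simp [vertexPoint, basisPoint])
  have hstar := (convex_faceHull F).starConvex (basisPoint_mem_faceHull hu)
  by_cases hau : a = u
  · subst hau
    rw [hδ.eq hstar (faceHull_subset_filledComplex hF)
      (within_refl (basisPoint_mem_faceHull ha))]
    exact .nil
  · have hadj := hF.adj ha hu hau
    rw [hδ.eq hstar (faceHull_subset_filledComplex hF) (edgeClass_within_face hadj ha hu)]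
    exact isEdgePath_edgeClass hadj

/-! ### Edge relations and the universal cover -/

lemma edgeClass_trans_symm {a b : V} (h : G.Adj a b) :
    (edgeClass h).trans (edgeClass h.symm) = .refl _ :=
  Within.eq ((convex_faceHull _).starConvex (basisPoint_mem_faceHull (Set.mem_insert _ _)))
    (faceHull_subset_filledComplex (isFace_pair h))
    ((edgeClass_within h).trans (edgeClass_within_face h.symm (by simp) (by simp)))
    (within_refl (basisPoint_mem_faceHull (by simp)))

lemma edgeClass_triangle {a b c : V} (hab : G.Adj a b) (hbc : G.Adj b c) (hac : G.Adj a c) :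
    (edgeClass hab).trans (edgeClass hbc) = edgeClass hac := by
  have hc := isShortCycle_triangle hab hbc hac.symm
  exact Within.eq (starConvex_closedStar _) (closedStar_subset_filledComplex _)
    ((edgeClass_within_closedStar hc hab (by simp)).trans
      (edgeClass_within_closedStar hc hbc (by simp)))
    (edgeClass_within_closedStar hc hac (by simp [Sym2.eq_swap (a := a) (b := c)]))

/-- Both routes lie in the disk filling the square. The inequalities ensure that the four edges form
a genuine cycle. -/
lemma edgeClass_square {a b b' c : V} (hab : G.Adj a b) (hab' : G.Adj a b') (hbc : G.Adj b c)
    (hbc' : G.Adj b' c) (hbb : b ≠ b') (hac : a ≠ c) :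
    (edgeClass hab).trans (edgeClass hbc) = (edgeClass hab').trans (edgeClass hbc') := by
  have hc := isShortCycle_square hab hbc hbc'.symm hab'.symm hac hbb
  exact Within.eq (starConvex_closedStar _) (closedStar_subset_filledComplex _)
    ((edgeClass_within_closedStar hc hab (by simp)).trans
      (edgeClass_within_closedStar hc hbc (by simp)))
    ((edgeClass_within_closedStar hc hab' (by simp [Sym2.eq_swap (a := a) (b := b')])).trans
      (edgeClass_within_closedStar hc hbc' (by simp [Sym2.eq_swap (a := b') (b := c)])))

open Classical in
/-- Append the edge from the endpoint of `x` to `b`, if there is one. -/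
noncomputable def appendEdge {p : G.filledComplex}
    (x : Σ a : V, Path.Homotopic.Quotient p (G.vertexPoint a)) (b : V) :
    Σ a : V, Path.Homotopic.Quotient p (G.vertexPoint a) :=
  if h : G.Adj x.1 b then ⟨b, x.2.trans (edgeClass h)⟩ else x

lemma appendEdge_mk {p : G.filledComplex} {a b : V} (h : G.Adj a b)
    (α : Path.Homotopic.Quotient p (G.vertexPoint a)) :
    appendEdge ⟨a, α⟩ b = ⟨b, α.trans (edgeClass h)⟩ :=
  dif_pos h

/-- The vertices of the universal cover of the complex, as homotopy classes of paths. -/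
noncomputable def universalCover (p : G.filledComplex) :
    G.ShortCycleCover (Σ a : V, Path.Homotopic.Quotient p (G.vertexPoint a)) where
  proj x := x.1
  step := appendEdge
  proj_step := by
    rintro ⟨a, α⟩ b (h : G.Adj a b)
    rw [appendEdge_mk h]
  step_back := by
    rintro ⟨a, α⟩ b (h : G.Adj a b)
    rw [appendEdge_mk h, appendEdge_mk h.symm, trans_assoc, edgeClass_trans_symm, trans_refl]
  step_triangle := by
    rintro ⟨a, α⟩ b c (hab : G.Adj a b) (hbc : G.Adj b c) (hac : G.Adj a c)
    rw [appendEdge_mk hab, appendEdge_mk hbc, appendEdge_mk hac, trans_assoc,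
      edgeClass_triangle hab hbc hac]
  step_square := by
    rintro ⟨a, α⟩ b b' c (hab : G.Adj a b) (hab' : G.Adj a b') (hbc : G.Adj b c)
      (hbc' : G.Adj b' c) hbb (hac : a ≠ c)
    rw [appendEdge_mk hab, appendEdge_mk hbc, appendEdge_mk hab', appendEdge_mk hbc',
      trans_assoc, trans_assoc, edgeClass_square hab hab' hbc hbc' hbb hac]

lemma IsEdgePath.exists_reaches {p : G.filledComplex} {a b : V}
    (δ : Path.Homotopic.Quotient p (G.vertexPoint a))
    {α : Path.Homotopic.Quotient (G.vertexPoint a) (G.vertexPoint b)} (h : IsEdgePath a b α) :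
    ∃ n, (universalCover p).Reaches ⟨a, δ⟩ n ⟨b, δ.trans α⟩ := by
  induction h with
  | nil => exact ⟨0, by rw [trans_refl]; exact .zero⟩
  | @snoc b c α _ h ih =>
    obtain ⟨n, hn⟩ := ih
    have hs := hn.succ (y := c) h
    refine ⟨n + 1, ?_⟩
    rw [← trans_assoc, ← appendEdge_mk h]
    exact hs

end SimpleGraph

theorem mainTheorem7 {V : Type*} [Fintype V] (G : MeasuredWeightedGraph V)
    (hconn : G.toSimpleGraph.Connected) (ρ : V → ℝ) (hCD : G.CD ρ ⊤)
    (hnonneg : ∀ x, 0 ≤ ρ x) (hpos : ∃ x, 0 < ρ x) (p : G.toSimpleGraph.filledComplex) :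
    Finite (FundamentalGroup G.toSimpleGraph.filledComplex p) := by
  obtain ⟨F, hF, hp⟩ := SimpleGraph.mem_filledComplex_iff.1 p.2
  obtain ⟨a, ha⟩ := hF.exists_vertex
  obtain ⟨δ, -⟩ := SimpleGraph.exists_within_face hF ha hp
  have hfin := MeasuredWeightedGraph.finite_cover (SimpleGraph.universalCover p) hconn hCD
    hnonneg hpos ⟨a, δ⟩ fun ⟨b, α⟩ => by
      have h := SimpleGraph.IsEdgePath.exists_reaches δ
        (SimpleGraph.isEdgePath (δ.symm.trans α))
      rwa [← Path.Homotopic.Quotient.trans_assoc, Path.Homotopic.Quotient.trans_symm,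
        Path.Homotopic.Quotient.refl_trans] at h
  -- Composition with `δ` embeds the loops at `p` into the fibre over `a`.
  let f : Path.Homotopic.Quotient p p → Σ b : V, Path.Homotopic.Quotient p
    (G.toSimpleGraph.vertexPoint b) := fun α => ⟨a, α.trans δ⟩
  have hf : Function.Injective f := by
    intro α β h
    have h1 : α.trans δ = β.trans δ := by simpa [f] using h
    have h2 := congrArg (fun η => η.trans δ.symm) h1
    simpa [Path.Homotopic.Quotient.trans_assoc] using h2
  exact Finite.of_injective f hf
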